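/- **Theorem.** Let $S\subset\mathbb{R}^2$ be a finite set of sites and $K$ a triangulation of $S$, for example the Delaunay triangulation: a geometric simplicial complex with vertex set $S$, in which every simplex is a face of a triangle, and whose triangles cover exactly the convex hull of $S$. Let a curvilinear triangulation over $K$ be given: each edge $e$ of $K$ is replaced by a NURBS $C_e(t)=\frac{\sum_{i=0}^n h_iN_{i,d}(t)P_i}{\sum_{i=0}^n h_iN_{i,d}(t)}$, $t\in[0,1]$, of arbitrary degree $d$, where the $N_{i,d}$ are the B-spline (Cox–de Boor) basis functions of a nondecreasing knot vector in $[0,1]$, the weights $h_i$ are nonnegative and the denominator does not vanish on $[0,1]$. The values $C_e(0)$ and $C_e(1)$ are the two end points of $e$, and the set of control points $\{P_0,\dots,P_n\}$ is the set of vertices of the triangles of $K$ that have $e$ as an edge. The rectilinear triangle of $T\in K$ is the convex hull of its three vertices; the curvilinear triangle of $T$ is the closed region enclosed by its three curved edges, that is, their union $B$ together with the bounded components of $\mathbb{R}^2\setminus B$. Let $p\in S$. The only $0$-spoke is the nucleus $\{p\}$; a $(k+1)$-spoke is a triangle that is not a spoke of lower order and shares a vertex with some $k$-spoke. The rectilinear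 (curvilinear) object space $\mathscr{O}_p^{rect}$ ($\mathscr{O}_p^{curv}$) with nucleus $p$ is the union over all $k\ge 0$ of the rectilinear (curvilinear) $k$-spokes. A boundary edge is an edge of a triangle of the object space that is not the intersection of two triangles of the object space; a triangle of the object space having it as an edge is called its boundary spoke. Then $$\mathscr{O}_p^{curv}\subseteq\mathscr{O}_p^{rect}.$$ Moreover, for every boundary edge $e$ and every boundary spoke $T$ that has $e$ as an edge, the control points of the NURBS $C_e$ are exactly the three vertices of $T$, and $C_e$ lies in the rectilinear triangle of $T$. -/

import Mathlib

open Set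

noncomputable section

/-- The Euclidean plane. -/
abbrev Plane : Type := EuclideanSpace ℝ (Fin 2)

/-- The B-spline basis functions `N_{i,j}` (first numerical argument after `m`: the degree `j`,
second: the index `i`) of the knot vector `T 0 ≤ T 1 ≤ ⋯ ≤ T m`, by the Cox–de Boor recursion
with the usual convention `x / 0 = 0`. Only `T 0, …, T m` matter for `i + j + 1 ≤ m`.
The knot spans are half open, except that, as usual, the last
nondegenerate one contains its right end point `T m`, so that curves are defined there too. -/
def bsplineBasis (T : ℕ → ℝ) (m : ℕ) : ℕ → ℕ → ℝ → ℝ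
  | 0, i, t =>
      open Classical in
      if T i < T (i + 1) ∧ T i ≤ t ∧ (t < T (i + 1) ∨ (t = T (i + 1) ∧ T (i + 1) = T m))
      then 1 else 0
  | j + 1, i, t =>
      (t - T i) / (T (i + j + 1) - T i) * bsplineBasis T m j i t
        + (T (i + j + 2) - t) / (T (i + j + 2) - T (i + 1)) * bsplineBasis T m j (i + 1) t

/-- A planar NURBS with control points `P_0, …, P_n`, nonnegative weights `h_0, …, h_n`, degree
`p` and nondecreasing knot vector `t_0, …, t_m` in `[0, 1]`, where `m = n + p + 1`.
The last field says that the quotient defining the curve makes sense for every parameter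
in `[0, 1]`. -/
structure NURBS where
  n : ℕ
  degree : ℕ
  knot : ℕ → ℝ
  ctrl : Fin (n + 1) → Plane
  weight : Fin (n + 1) → ℝ
  knot_mono : ∀ i j, i ≤ j → j ≤ n + degree + 1 → knot i ≤ knot j
  knot_mem : ∀ i, i ≤ n + degree + 1 → knot i ∈ Icc (0 : ℝ) 1
  weight_nonneg : ∀ i, 0 ≤ weight i
  denom_ne_zero : ∀ t ∈ Icc (0 : ℝ) 1,
    ∑ i : Fin (n + 1), weight i * bsplineBasis knot (n + degree + 1) degree i t ≠ 0

/-- `C(t) = (∑ h_i N_{i,p}(t) P_i) / (∑ h_i N_{i,p}(t))`. -/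
def NURBS.curve (C : NURBS) (t : ℝ) : Plane :=
  (∑ i : Fin (C.n + 1),
      C.weight i * bsplineBasis C.knot (C.n + C.degree + 1) C.degree i t)⁻¹ •
    ∑ i : Fin (C.n + 1),
      (C.weight i * bsplineBasis C.knot (C.n + C.degree + 1) C.degree i t) • C.ctrl i

/-- The set of points of a NURBS, for parameters in `[0, 1]`. -/
def NURBS.image (C : NURBS) : Set Plane := C.curve '' Icc (0 : ℝ) 1

/-- `K` is a (rectilinear) triangulation of the finite set of sites `S`: a geometric simplicial
complex, each simplex of which is a face of a triangle, whose vertices are the sites and which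
subdivides the convex hull of `S`. Delaunay triangulations are of this kind. -/
structure IsTriangulation (S : Finset Plane) (K : Geometry.SimplicialComplex ℝ Plane) : Prop where
  vertices_eq : K.vertices = (S : Set Plane)
  pure : ∀ s ∈ K.faces, ∃ T ∈ K.faces, T.card = 3 ∧ s ⊆ T
  space_eq : K.space = convexHull ℝ (S : Set Plane)

/-- The triangles (2-simplices) of a complex, as vertex sets. -/
def triangles (K : Geometry.SimplicialComplex ℝ Plane) : Set (Finset Plane) :=
  {T | T ∈ K.faces ∧ T.card = 3}

/-- The edges (1-simplices) of a complex, as vertex sets. -/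
def edges (K : Geometry.SimplicialComplex ℝ Plane) : Set (Finset Plane) :=
  {e | e ∈ K.faces ∧ e.card = 2}

/-- The `k`-spokes with nucleus `p`. The only 0-spoke is the nucleus; a `(k+1)`-spoke is a
triangle that is not a spoke of lower order and that meets a `k`-spoke. Simplices are given by
their vertex sets; two simplices of a complex meet iff they share a vertex. -/
def spokes (K : Geometry.SimplicialComplex ℝ Plane) (p : Plane) : ℕ → Set (Finset Plane)
  | 0 => {{p}}
  | k + 1 => {T | T ∈ triangles K ∧ (∀ j : Fin (k + 1), T ∉ spokes K p j) ∧
      ∃ U ∈ spokes K p k, ∃ v, v ∈ T ∧ v ∈ U}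
  termination_by k => k

/-- The `k`-spoke complex: the union of all `k`-spokes, where `real s` is the point set that
realizes the simplex `s` (rectilinearly or curvilinearly). -/
def spokeComplex (K : Geometry.SimplicialComplex ℝ Plane) (real : Finset Plane → Set Plane)
    (p : Plane) (k : ℕ) : Set Plane :=
  ⋃ s ∈ spokes K p k, real s

/-- The object space with nucleus `p`: the union of all `k`-spoke complexes. -/
def objectSpace (K : Geometry.SimplicialComplex ℝ Plane) (real : Finset Plane → Set Plane)
    (p : Plane) : Set Plane :=
  ⋃ k : ℕ, spokeComplex K real p k

/-- The rectilinear (filled) simplex with vertex set `s`. -/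
def rectSimplex (s : Finset Plane) : Set Plane := convexHull ℝ (s : Set Plane)

/-- The closed region enclosed by `B`: the points of `B`, and the points that `B` separates
from infinity. -/
def enclosedRegion (B : Set Plane) : Set Plane :=
  B ∪ {x | x ∉ B ∧ Bornology.IsBounded (connectedComponentIn Bᶜ x)}

/-- A curvilinear triangulation over the rectilinear one `K`: each edge `e` is
replaced by a NURBS between the two end points of `e`, the control points of which are the
vertices of the triangles that have `e` as an edge (three points if `e` lies in one triangle,
four if it lies in two). -/
structure CurvilinearTriangulation (K : Geometry.SimplicialComplex ℝ Plane) where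
  edgeCurve : Finset Plane → NURBS
  endpoints : ∀ e ∈ edges K,
    ({(edgeCurve e).curve 0, (edgeCurve e).curve 1} : Set Plane) = (e : Set Plane)
  control : ∀ e ∈ edges K,
    range (edgeCurve e).ctrl = {v | ∃ T ∈ triangles K, e ⊆ T ∧ v ∈ T}

/-- The curvilinear (filled) simplex that corresponds to the simplex `s` of `K`: for a triangle,
the closed region enclosed by its three edge curves; for a vertex, the vertex itself. -/
def CurvilinearTriangulation.simplex {K : Geometry.SimplicialComplex ℝ Plane}
    (C : CurvilinearTriangulation K) (s : Finset Plane) : Set Plane :=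
  (s : Set Plane) ∪ enclosedRegion (⋃ e ∈ {e | e ∈ edges K ∧ e ⊆ s}, (C.edgeCurve e).image)

/-- The rectilinear object space with nucleus `p`. -/
def rectObjectSpace (K : Geometry.SimplicialComplex ℝ Plane) (p : Plane) : Set Plane :=
  objectSpace K rectSimplex p

/-- The curvilinear object space with nucleus `p`. -/
def curvObjectSpace {K : Geometry.SimplicialComplex ℝ Plane}
    (C : CurvilinearTriangulation K) (p : Plane) : Set Plane :=
  objectSpace K C.simplex p

/-- The triangles that belong to the object space with nucleus `p`. -/
def objectTriangles (K : Geometry.SimplicialComplex ℝ Plane) (p : Plane) : Set (Finset Plane) :=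
  {T | T ∈ triangles K ∧ ∃ k, T ∈ spokes K p k}

/-- The boundary edges of the object space: the edges of its triangles that are not the
intersection of two of its triangles. -/
def boundaryEdges (K : Geometry.SimplicialComplex ℝ Plane) (p : Plane) : Set (Finset Plane) :=
  {e | e ∈ edges K ∧ (∃ T ∈ objectTriangles K p, e ⊆ T) ∧
    ¬ ∃ A ∈ objectTriangles K p, ∃ B ∈ objectTriangles K p,
      (e : Set Plane) = (A : Set Plane) ∩ (B : Set Plane)}

end

/-!
Two facts carry the theorem. First, B-spline basis functions are nonnegative, so every point of a
NURBS with nonnegative weights is a convex combination of its control points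
(`NURBS.image_subset_convexHull`). Second, a set contained in a convex set `D` encloses nothing
outside `D`: from a point outside `D` one escapes to infinity along the ray pointing away from a
point of `D` (`enclosedRegion_subset_of_convex`). Hence every curvilinear triangle lies in the
convex hull of the sites.

This hull is the whole rectilinear object space: the union of the triangles that are spokes and the
union of the triangles that are not are closed, they are disjoint because triangles of a complex
without a common vertex are disjoint, and they cover the connected set `convexHull ℝ S`. Since the
nucleus lies on a spoke, all triangles are spokes (`exists_mem_spokes`).

Finally, two distinct triangles that share an edge `e` intersect exactly in `e`. So a boundary edge
lies in only one triangle `T`, the vertices of which are thus the control points of its curve.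
-/

/-! ### B-splines and the convex hull property of NURBS -/

lemma mem_Icc_of_bsplineBasis_ne_zero {T : ℕ → ℝ} {m : ℕ}
    (hT : ∀ i j, i ≤ j → j ≤ m → T i ≤ T j) (j i : ℕ) (t : ℝ) (hm : i + j + 1 ≤ m)
    (h : bsplineBasis T m j i t ≠ 0) : t ∈ Icc (T i) (T (i + j + 1)) := by
  induction j generalizing i with
  | zero =>
    simp only [bsplineBasis, ne_eq, ite_eq_right_iff, one_ne_zero, imp_false, not_not] at h
    exact ⟨h.2.1, h.2.2.elim le_of_lt fun h' => h'.1.le⟩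
  | succ j ih =>
    rw [bsplineBasis] at h
    by_cases h₁ : bsplineBasis T m j i t = 0
    · have h₂ : bsplineBasis T m j (i + 1) t ≠ 0 := fun h₂ => h (by simp [h₁, h₂])
      have h₃ := ih (i + 1) (by omega) h₂
      refine ⟨(hT _ _ (by omega) (by omega)).trans h₃.1, h₃.2.trans (hT _ _ (by omega) (by omega))⟩
    · have h₃ := ih i (by omega) h₁
      exact ⟨h₃.1, h₃.2.trans (hT _ _ (by omega) (by omega))⟩

lemma bsplineBasis_nonneg {T : ℕ → ℝ} {m : ℕ}
    (hT : ∀ i j, i ≤ j → j ≤ m → T i ≤ T j) (j i : ℕ) (t : ℝ) (hm : i + j + 1 ≤ m) :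
    0 ≤ bsplineBasis T m j i t := by
  induction j generalizing i with
  | zero =>
    rw [bsplineBasis]
    split_ifs <;> norm_num
  | succ j ih =>
    rw [bsplineBasis]
    -- The coefficients may be negative, but only outside the supports of their basis functions.
    refine add_nonneg ?_ ?_
    · by_cases h : bsplineBasis T m j i t = 0
      · simp [h]
      have ht := mem_Icc_of_bsplineBasis_ne_zero hT j i t (by omega) h
      exact mul_nonneg (div_nonneg (sub_nonneg.2 ht.1)
        (sub_nonneg.2 (hT _ _ (by omega) (by omega)))) (ih i (by omega))
    · by_cases h : bsplineBasis T m j (i + 1) t = 0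
      · simp [h]
      have ht := mem_Icc_of_bsplineBasis_ne_zero hT j (i + 1) t (by omega) h
      rw [show i + 1 + j + 1 = i + j + 2 by omega] at ht
      exact mul_nonneg (div_nonneg (sub_nonneg.2 ht.2)
        (sub_nonneg.2 (hT _ _ (by omega) (by omega)))) (ih (i + 1) (by omega))

theorem NURBS.image_subset_convexHull (C : NURBS) : C.image ⊆ convexHull ℝ (range C.ctrl) := by
  rintro _ ⟨t, ht, rfl⟩
  have hnonneg : ∀ i ∈ (Finset.univ : Finset (Fin (C.n + 1))),
      0 ≤ C.weight i * bsplineBasis C.knot (C.n + C.degree + 1) C.degree i t := fun i _ =>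
    mul_nonneg (C.weight_nonneg i) (bsplineBasis_nonneg C.knot_mono _ _ _ (by omega))
  exact Finset.centerMass_mem_convexHull _ hnonneg
    ((Finset.sum_nonneg hnonneg).lt_of_ne' (C.denom_ne_zero t ht)) fun i _ => mem_range_self i

/-! ### Enclosed regions -/

theorem enclosedRegion_subset_of_convex {B D : Set Plane} (hD : Convex ℝ D) (hne : D.Nonempty)
    (hBD : B ⊆ D) : enclosedRegion B ⊆ D := by
  rintro x (hx | ⟨-, hbdd⟩)
  · exact hBD hx
  by_contra hxD
  obtain ⟨a, ha⟩ := hne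
  have hxa : x - a ≠ 0 := fun h => hxD (sub_eq_zero.1 h ▸ ha)
  let ray : ℝ → Plane := fun s => x + s • (x - a)
  have hconn : IsPreconnected (ray '' Ici 0) :=
    isPreconnected_Ici.image _ (by fun_prop)
  have hray : ray '' Ici 0 ⊆ Bᶜ := by
    rintro _ ⟨s, hs, rfl⟩ hsB
    have hs0 : (0 : ℝ) ≤ s := hs
    have hs1 : (1 + s : ℝ) ≠ 0 := by positivity
    -- `x` lies on the segment from `a` to `ray s`, hence in `D`.
    have hmem := hD ha (hBD hsB) (a := s / (1 + s)) (b := 1 / (1 + s)) (by positivity)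
      (by positivity) (by field_simp; ring)
    apply hxD
    convert! hmem using 1
    simp only [ray]
    match_scalars <;> field_simp
    ring
  have hsub := hconn.subset_connectedComponentIn (x := x) ⟨0, self_mem_Ici, by simp [ray]⟩ hray
  obtain ⟨R, hR⟩ := (hbdd.subset hsub).exists_norm_le
  have hpos : 0 < ‖x - a‖ := norm_pos_iff.2 hxa
  have hR0 : 0 ≤ R := (norm_nonneg _).trans (hR _ ⟨0, self_mem_Ici, rfl⟩)
  let s := (R + ‖x‖ + 1) / ‖x - a‖
  have hs : 0 ≤ s := by positivity
  have h₁ : ‖s • (x - a)‖ = R + ‖x‖ + 1 := by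
    rw [norm_smul, Real.norm_of_nonneg hs, div_mul_cancel₀ _ hpos.ne']
  have h₂ : ‖s • (x - a)‖ ≤ ‖ray s‖ + ‖x‖ := by
    simpa [ray] using norm_sub_le (ray s) x
  linarith [hR _ ⟨s, hs, rfl⟩]

/-! ### Triangles and spokes -/

section

variable {S : Finset Plane} {K : Geometry.SimplicialComplex ℝ Plane} {p : Plane}

lemma IsTriangulation.coe_face_subset (hK : IsTriangulation S K) {s : Finset Plane}
    (hs : s ∈ K.faces) : (s : Set Plane) ⊆ S := by
  rw [← hK.vertices_eq, Geometry.SimplicialComplex.vertices_eq]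
  exact subset_biUnion_of_mem (u := fun k : Finset Plane => (k : Set Plane)) hs

lemma IsTriangulation.finite_triangles (hK : IsTriangulation S K) : (triangles K).Finite :=
  S.powerset.finite_toSet.subset fun _ hT =>
    Finset.mem_coe.2 (Finset.mem_powerset.2 (Finset.coe_subset.1 (hK.coe_face_subset hT.1)))

lemma IsTriangulation.exists_triangle_of_mem (hK : IsTriangulation S K) {x : Plane}
    (hx : x ∈ convexHull ℝ (S : Set Plane)) : ∃ T ∈ triangles K, x ∈ rectSimplex T := by
  rw [← hK.space_eq, Geometry.SimplicialComplex.mem_space_iff] at hx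
  obtain ⟨s, hs, hxs⟩ := hx
  obtain ⟨T, hT, hcard, hsT⟩ := hK.pure s hs
  exact ⟨T, ⟨hT, hcard⟩, convexHull_mono (Finset.coe_subset.2 hsT) hxs⟩

lemma isClosed_biUnion_rectSimplex {F : Set (Finset Plane)} (hF : F.Finite) :
    IsClosed (⋃ T ∈ F, rectSimplex T) :=
  hF.isClosed_biUnion fun T _ => T.finite_toSet.isClosed_convexHull ℝ

lemma exists_mem_spokes_of_common_vertex {U T : Finset Plane} {v : Plane} {k : ℕ}
    (hU : U ∈ spokes K p k) (hT : T ∈ triangles K) (hvT : v ∈ T) (hvU : v ∈ U) :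
    ∃ j, T ∈ spokes K p j := by
  by_contra! h
  exact h (k + 1) (by rw [spokes]; exact ⟨hT, fun j => h j, U, hU, v, hvT, hvU⟩)

theorem exists_mem_spokes (hK : IsTriangulation S K) (hp : p ∈ S) {T : Finset Plane}
    (hT : T ∈ triangles K) : ∃ k, T ∈ spokes K p k := by
  by_contra hnot
  let F : Set (Finset Plane) := {T | T ∈ triangles K ∧ ∃ k, T ∈ spokes K p k}
  let G : Set (Finset Plane) := {T | T ∈ triangles K ∧ ¬ ∃ k, T ∈ spokes K p k}
  have hF : IsClosed (⋃ T ∈ F, rectSimplex T) :=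
    isClosed_biUnion_rectSimplex (hK.finite_triangles.subset fun _ h => h.1)
  have hG : IsClosed (⋃ T ∈ G, rectSimplex T) :=
    isClosed_biUnion_rectSimplex (hK.finite_triangles.subset fun _ h => h.1)
  have hcover : convexHull ℝ (S : Set Plane) ⊆
      (⋃ T ∈ F, rectSimplex T) ∪ ⋃ T ∈ G, rectSimplex T := by
    intro x hx
    obtain ⟨U, hU, hxU⟩ := hK.exists_triangle_of_mem hx
    by_cases h : ∃ k, U ∈ spokes K p k
    · exact Or.inl (mem_biUnion (show U ∈ F from ⟨hU, h⟩) hxU)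
    · exact Or.inr (mem_biUnion (show U ∈ G from ⟨hU, h⟩) hxU)
  have hpK : {p} ∈ K.faces := by
    rw [← Geometry.SimplicialComplex.mem_vertices, hK.vertices_eq]
    exact hp
  obtain ⟨U, hU, hcard, hpU⟩ := hK.pure _ hpK
  have hpU' : p ∈ U := Finset.singleton_subset_iff.1 hpU
  have hUF : U ∈ F := ⟨⟨hU, hcard⟩, exists_mem_spokes_of_common_vertex (U := {p}) (k := 0)
    (by rw [spokes]; rfl) ⟨hU, hcard⟩ hpU' (Finset.mem_singleton_self p)⟩
  obtain ⟨v, hv⟩ := Geometry.SimplicialComplex.nonempty_of_mem_faces hT.1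
  have hconn := (convex_convexHull ℝ (S : Set Plane)).isPreconnected
  obtain ⟨x, -, hxF, hxG⟩ := isPreconnected_closed_iff.1 hconn _ _ hF hG hcover
    ⟨p, subset_convexHull ℝ _ hp, mem_biUnion hUF (subset_convexHull ℝ _ hpU')⟩
    ⟨v, subset_convexHull ℝ _ (hK.coe_face_subset hT.1 hv),
      mem_biUnion (show T ∈ G from ⟨hT, hnot⟩) (subset_convexHull ℝ _ hv)⟩
  simp only [mem_iUnion] at hxF hxG
  obtain ⟨A, ⟨hA, k, hAk⟩, hxA⟩ := hxF
  obtain ⟨B, ⟨hB, hBk⟩, hxB⟩ := hxG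
  -- A point common to two triangles forces a common vertex.
  obtain ⟨w, hwA, hwB⟩ := convexHull_nonempty_iff.1
    ⟨x, K.inter_subset_convexHull hA.1 hB.1 ⟨hxA, hxB⟩⟩
  exact hBk (exists_mem_spokes_of_common_vertex hAk hB hwB hwA)

theorem convexHull_subset_rectObjectSpace (hK : IsTriangulation S K) (hp : p ∈ S) :
    convexHull ℝ (S : Set Plane) ⊆ rectObjectSpace K p := by
  intro x hx
  obtain ⟨T, hT, hxT⟩ := hK.exists_triangle_of_mem hx
  obtain ⟨k, hk⟩ := exists_mem_spokes hK hp hT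
  exact mem_iUnion.2 ⟨k, mem_biUnion hk hxT⟩

lemma coe_subset_of_mem_spokes (hK : IsTriangulation S K) (hp : p ∈ S) {k : ℕ} {s : Finset Plane}
    (hs : s ∈ spokes K p k) : (s : Set Plane) ⊆ S := by
  cases k with
  | zero =>
    rw [spokes, mem_singleton_iff] at hs
    simpa [hs] using hp
  | succ k =>
    rw [spokes] at hs
    exact hK.coe_face_subset hs.1.1

lemma CurvilinearTriangulation.simplex_subset_convexHull (C : CurvilinearTriangulation K)
    (hK : IsTriangulation S K) {s : Finset Plane} (hne : S.Nonempty) (hs : (s : Set Plane) ⊆ S) :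
    C.simplex s ⊆ convexHull ℝ (S : Set Plane) := by
  refine union_subset (hs.trans (subset_convexHull ℝ _))
    (enclosedRegion_subset_of_convex (convex_convexHull ℝ _) (Finset.coe_nonempty.2 hne).convexHull ?_)
  refine iUnion₂_subset fun e he =>
    (C.edgeCurve e).image_subset_convexHull.trans (convexHull_mono ?_)
  rw [C.control e he.1]
  rintro v ⟨T, hT, -, hv⟩
  exact hK.coe_face_subset hT.1 hv

lemma coe_inter_eq_of_common_edge {A B e : Finset Plane} (hA : A ∈ triangles K)
    (hB : B ∈ triangles K) (hAB : A ≠ B) (he : e ∈ edges K) (heA : e ⊆ A) (heB : e ⊆ B) :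
    (e : Set Plane) = (A : Set Plane) ∩ (B : Set Plane) := by
  classical
  rw [← Finset.coe_inter, Finset.coe_inj]
  refine Finset.eq_of_subset_of_card_le (Finset.subset_inter heA heB) ?_
  have hlt : (A ∩ B).card < A.card := Finset.card_lt_card <|
    Finset.inter_subset_left.ssubset_of_ne fun h => hAB <|
      Finset.eq_of_subset_of_card_le (Finset.inter_eq_left.1 h) (by rw [hA.2, hB.2])
  have := hA.2
  have := he.2
  omega

end

theorem mainTheorem2 (S : Finset Plane) (K : Geometry.SimplicialComplex ℝ Plane)
    (hK : IsTriangulation S K) (C : CurvilinearTriangulation K) (p : Plane) (hp : p ∈ S) :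
    curvObjectSpace C p ⊆ rectObjectSpace K p ∧
      ∀ e ∈ boundaryEdges K p, ∀ T ∈ objectTriangles K p, e ⊆ T →
        range (C.edgeCurve e).ctrl = (T : Set Plane) ∧
          (C.edgeCurve e).image ⊆ rectSimplex T := by
  refine ⟨?_, fun e he T hT heT => ?_⟩
  · refine Subset.trans ?_ (convexHull_subset_rectObjectSpace hK hp)
    exact iUnion_subset fun k => iUnion₂_subset fun s hs =>
      C.simplex_subset_convexHull hK ⟨p, hp⟩ (coe_subset_of_mem_spokes hK hp hs)
  · have hctrl : range (C.edgeCurve e).ctrl = (T : Set Plane) := by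
      rw [C.control e he.1]
      refine Subset.antisymm ?_ fun v hv => ⟨T, hT.1, heT, hv⟩
      rintro v ⟨U, hU, heU, hv⟩
      by_contra hvT
      have hUT : T ≠ U := fun h => hvT (h ▸ hv)
      exact he.2.2 ⟨T, hT, U, ⟨hU, exists_mem_spokes hK hp hU⟩,
        coe_inter_eq_of_common_edge hT.1 hU hUT he.1 heT heU⟩
    refine ⟨hctrl, ?_⟩
    rw [rectSimplex, ← hctrl]
    exact (C.edgeCurve e).image_subset_convexHull
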